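/- Let $\mathbb F$ be a finite field with $q$ elements, let $0<\rho\le 1-\frac1q$, and let $H_q(x)=x\log_q(q-1)-x\log_q x-(1-x)\log_q(1-x)$ be the $q$-ary entropy function. A set $\mathcal X\subseteq\mathbb F^n$ is $\rho$-covered by a code $\mathcal C\subseteq\mathbb F^n$ if every $\mathbf x\in\mathcal X$ is at Hamming distance at most $\rho n$ from some codeword of $\mathcal C$. For $\tau\in[0,1]$, the code $\mathcal C$ is $(\rho,\tau)$-partial covering if it $\rho$-covers some set $\mathcal X\subseteq\mathbb F^n$ with $|\mathcal X|=\lceil q^{n(1-\tau)}\rceil$. For $0\le k\le n$ let $\mathcal C_{k,n}$ be the ensemble of the linear codes generated by the rows of all $k\times n$ matrices over $\mathbb F$ (each of the $q^{kn}$ matrices counted once). (i) There is a constant $A$, depending only on $q$ and $\rho$, such that for every sequence $\tau_n\in[0,1-H_q(\rho)]$ (in particular for every constant $\tau$ in this interval) there is a sequence of integers $0\le k_n\le n$ with $$\frac{k_n}{n}\le 1-\tau_n-H_q(\rho)+A\,\frac{\log_q n}{n}\quad\text{for all sufficiently large }n,$$ for which the fraction of the codes in $\mathcal C_{k_n,n}$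 that are $(\rho,\tau_n)$-partial covering tends to $1$ as $n\to\infty$. (ii) Thus, in the limit of large $n$, almost all linear codes of rate above $1-\tau-H_q(\rho)$ are $(\rho,\tau)$-partial covering: for every sequence $\tau_n\in[0,1-H_q(\rho)]$, every $\varepsilon>0$ and all integers $0\le k_n\le n$ with $\frac{k_n}{n}\ge 1-\tau_n-H_q(\rho)+\varepsilon$ for all sufficiently large $n$, the fraction of the codes in $\mathcal C_{k_n,n}$ that are $(\rho,\tau_n)$-partial covering tends to $1$ as $n\to\infty$. -/

import Mathlib

open Filter Topology

/-- The `q`-ary entropy function in base-`q` units (Mathlib's `Real.qaryEntropy` is in nats). -/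
noncomputable def entropyBase (q : ℕ) (x : ℝ) : ℝ :=
  Real.qaryEntropy q x / Real.log q

/-- `H_q(x) = x log_q (q - 1) - x log_q x - (1 - x) log_q (1 - x)`. -/
theorem entropyBase_eq (q : ℕ) (x : ℝ) :
    entropyBase q x =
      x * Real.logb q ((q : ℝ) - 1) - x * Real.logb q x - (1 - x) * Real.logb q (1 - x) := by
  unfold entropyBase Real.qaryEntropy Real.binEntropy Real.logb
  rw [Real.log_inv, Real.log_inv]
  push_cast
  ring

/-- `X` is `ρ`-covered by `C`: every vector of `X` is at Hamming distance at most `ρ n` from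
some (equivalently, from a nearest) codeword. -/
def RhoCovers {F : Type*} [DecidableEq F] {n : ℕ} (ρ : ℝ) (C X : Set (Fin n → F)) : Prop :=
  ∀ x ∈ X, ∃ c ∈ C, (hammingDist x c : ℝ) ≤ ρ * n

/-- `C` is a `(ρ, τ)`-partial covering code: it `ρ`-covers some set of `q ^ (n (1 - τ))` vectors,
`q` being the alphabet size. As `q ^ (n (1 - τ))` need not be an integer, it is rounded up. -/
def IsPartialCovering {F : Type*} [Fintype F] [DecidableEq F] {n : ℕ} (ρ τ : ℝ)
    (C : Set (Fin n → F)) : Prop :=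
  ∃ X : Finset (Fin n → F),
    X.card = ⌈(Fintype.card F : ℝ) ^ ((n : ℝ) * (1 - τ))⌉₊ ∧ RhoCovers ρ C (X : Set (Fin n → F))

/-- The linear code generated by the rows of `G`. -/
def generatedCode {F : Type*} [Field F] {k n : ℕ} (G : Matrix (Fin k) (Fin n) F) :
    Submodule F (Fin n → F) :=
  LinearMap.range G.vecMulLinear

/-- The fraction of `(ρ, τ)`-partial covering codes in the ensemble of the linear codes generated
by all `k × n` matrices over `F`, each matrix being counted once. -/
noncomputable def partialCoveringFraction (F : Type*) [Field F] [Fintype F] [DecidableEq F]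
    (k n : ℕ) (ρ τ : ℝ) : ℝ :=
  (Nat.card {G : Matrix (Fin k) (Fin n) F //
      IsPartialCovering ρ τ (generatedCode G : Set (Fin n → F))} : ℝ) /
    (Nat.card (Matrix (Fin k) (Fin n) F) : ℝ)

/-!
Write `μ` for the average number of codewords within distance `ρ n` of a vector, for a random code
with `k` generators; `μ = q ^ (k - n) |B|` with `B` the Hamming ball of radius `ρ n`, and
`|B| ≥ c q ^ (n H_q(ρ)) / n`. So `k = n (1 - τ - H_q(ρ)) + O(log_q n)` generators are enough
for `μ ≥ n ^ 5 q ^ (-n τ)`.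

A combination of random generators with coefficients not all zero is uniformly distributed, so the
second moment of the number of codewords covering a random vector is at most `μ + μ ^ 2` on
average (`expect_expect_coverCount_sq_le`). Two conclusions follow.

* By the Cauchy–Schwarz inequality, with high probability the covered fraction is at least
  `μ / (n (1 + μ))` (`freq_freq_covered_lt_le`). If `q ^ (-n τ) ≤ n ^ (-2)`, this is at least
  `q ^ (-n τ)`, as required.
* By Chebyshev's inequality, the uncovered fraction is at most `1 / μ` on average
  (`expect_freq_uncovered_le`). If `q ^ (-n τ) > n ^ (-2)`, then `μ > n ^ 3`, and with high
  probability the uncovered fraction is at most `n ^ (-2)`.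

In the second case almost the whole space may be required (all of it if `τ = 0`), and the second
moment does not give that. But adjoining a random generator `x` squares the uncovered fraction on
average, since `z` stays uncovered only if both `z` and `z - x` were uncovered
(`expect_freq_uncovered_sup_span_le`). Hence `O(log n)` further generators bring the uncovered
fraction below `q ^ (-n)`, that is, to zero (`freq_exists_uncovered_le`). They cost only a term
`O(log_q n)` in `k`.

The estimate `one_sub_div_le_partialCoveringFraction` combines the two cases for a fixed `n`; being
uniform in `τ`, it applies to arbitrary sequences `τ n`.
-/

open scoped BigOperators

/-! ### Uniform probability on a finite type -/

open Classical in
/-- The fraction of the elements of a finite type that satisfy `p`, i.e. the probability of `p`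
under the uniform distribution. -/
noncomputable def freq {Ω : Type*} [Fintype Ω] (p : Ω → Prop) : ℝ :=
  𝔼 ω, if p ω then (1 : ℝ) else 0

section Freq

variable {Ω Ω' : Type*} [Fintype Ω] [Fintype Ω']

theorem freq_eq_card_div (p : Ω → Prop) :
    freq p = (Nat.card {ω // p ω} : ℝ) / Nat.card Ω := by
  classical
  rw [freq, Fintype.expect_eq_sum_div_card, Finset.sum_boole, Nat.card_eq_fintype_card,
    Nat.card_eq_fintype_card, Fintype.card_subtype]

theorem freq_nonneg (p : Ω → Prop) : 0 ≤ freq p :=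
  Finset.expect_nonneg fun ω _ => by split_ifs <;> norm_num

theorem freq_mono {p r : Ω → Prop} (h : ∀ ω, p ω → r ω) : freq p ≤ freq r := by
  refine Finset.expect_le_expect fun ω _ => ?_
  split_ifs with h1 h2 h2
  · exact le_rfl
  · exact absurd (h ω h1) h2
  · exact zero_le_one
  · exact le_rfl

theorem freq_equiv (e : Ω ≃ Ω') (p : Ω' → Prop) : freq (fun ω => p (e ω)) = freq p :=
  Fintype.expect_equiv e _ _ fun _ => rfl

theorem freq_not [Nonempty Ω] (p : Ω → Prop) : freq (fun ω => ¬ p ω) = 1 - freq p := by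
  rw [eq_sub_iff_add_eq, freq, freq, ← Finset.expect_add_distrib]
  rw [← Fintype.expect_one (ι := Ω) (M := ℝ)]
  refine Finset.expect_congr rfl fun ω _ => ?_
  split_ifs <;> norm_num

/-- Markov's inequality. -/
theorem freq_lt_le_expect_div (f : Ω → ℝ) (hf : ∀ ω, 0 ≤ f ω) {t : ℝ} (ht : 0 < t) :
    freq (fun ω => t < f ω) ≤ (𝔼 ω, f ω) / t := by
  rw [Finset.expect_div]
  refine Finset.expect_le_expect fun ω _ => ?_
  split_ifs with h
  · exact (one_le_div ht).2 h.le
  · exact div_nonneg (hf ω) ht.le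

/-- If `p (ω, ·)` has probability at most `ε` unless `ω` is bad, then `p` has probability at most
that of being bad plus `ε`. -/
theorem freq_prod_le (p : Ω × Ω' → Prop) (bad : Ω → Prop) {ε : ℝ} (hε : 0 ≤ ε)
    (h : ∀ ω, ¬ bad ω → freq (fun ω' => p (ω, ω')) ≤ ε) : freq p ≤ freq bad + ε := by
  classical
  rcases isEmpty_or_nonempty Ω with hΩ | hΩ
  · simpa [freq] using hε
  rcases isEmpty_or_nonempty Ω' with hΩ' | hΩ'
  · have : freq p = 0 := by simp [freq]
    rw [this]
    exact add_nonneg (freq_nonneg _) hε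
  rw [freq, ← Finset.univ_product_univ, Finset.expect_product, freq,
    ← Fintype.expect_const (ι := Ω) ε, ← Finset.expect_add_distrib]
  refine Finset.expect_le_expect fun ω _ => ?_
  split_ifs with hb
  · refine (Finset.expect_le (a := (1 : ℝ)) Finset.univ_nonempty fun ω' _ => ?_).trans
      (le_add_of_nonneg_right (by simpa using hε))
    split_ifs <;> norm_num
  · simpa [freq] using h ω hb

/-- An event whose probability is less than that of a single point is empty. -/
theorem not_of_freq_lt {p : Ω → Prop} (h : freq p < 1 / Nat.card Ω) (ω : Ω) : ¬ p ω := by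
  intro hω
  rw [freq_eq_card_div] at h
  have : Nonempty Ω := ⟨ω⟩
  have hN : (0 : ℝ) < Nat.card Ω := by exact_mod_cast Nat.card_pos
  rw [div_lt_div_iff_of_pos_right hN] at h
  have : Nonempty {ω // p ω} := ⟨⟨ω, hω⟩⟩
  have h1 : 1 ≤ Nat.card {ω // p ω} := Nat.card_pos
  have : (1 : ℝ) ≤ Nat.card {ω // p ω} := by exact_mod_cast h1
  linarith

end Freq

/-! ### Adjoining random generators: the uncovered fraction squares -/

section Doubling

variable {F V : Type*} [Field F] [AddCommGroup V] [Module F V]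

/-- `z` is not covered by the translates `c + B` of `B` by the codewords `c ∈ C`. -/
def Uncovered (B : Finset V) (C : Submodule F V) (z : V) : Prop :=
  ∀ c ∈ C, z - c ∉ B

theorem Uncovered.anti {B : Finset V} {C D : Submodule F V} (h : C ≤ D) {z : V}
    (hz : Uncovered B D z) : Uncovered B C z :=
  fun c hc => hz c (h hc)

variable [Fintype V]

theorem expect_add_right (f : V → ℝ) (v : V) : 𝔼 x, f (x + v) = 𝔼 x, f x :=
  Fintype.expect_equiv (Equiv.addRight v) _ _ fun _ => rfl

/-- Adjoining a random vector to a code squares the uncovered fraction, on average: a vector `z`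
left uncovered by the larger code is uncovered by the smaller one, and so is `z - x`. -/
theorem expect_freq_uncovered_sup_span_le (B : Finset V) (C : Submodule F V) :
    𝔼 x : V, freq (Uncovered B (C ⊔ Submodule.span F {x})) ≤ freq (Uncovered B C) ^ 2 := by
  classical
  have key : ∀ x z : V, Uncovered B (C ⊔ Submodule.span F {x}) z →
      Uncovered B C z ∧ Uncovered B C (z - x) := by
    refine fun x z h => ⟨h.anti le_sup_left, fun c hc hB => h (x + c) ?_ ?_⟩
    · exact add_mem (Submodule.mem_sup_right (Submodule.mem_span_singleton_self x))
        (Submodule.mem_sup_left hc)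
    · rwa [← sub_sub]
  calc 𝔼 x : V, freq (Uncovered B (C ⊔ Submodule.span F {x}))
      ≤ 𝔼 x : V, 𝔼 z : V, (if Uncovered B C z then (1 : ℝ) else 0) *
          (if Uncovered B C (z - x) then 1 else 0) := by
        refine Finset.expect_le_expect fun x _ => Finset.expect_le_expect fun z _ => ?_
        by_cases h : Uncovered B (C ⊔ Submodule.span F {x}) z
        · obtain ⟨h1, h2⟩ := key x z h
          simp [h, h1, h2]
        · rw [if_neg h]
          split_ifs <;> norm_num
    _ = 𝔼 z : V, (if Uncovered B C z then (1 : ℝ) else 0) * freq (Uncovered B C) := by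
        rw [Finset.expect_comm]
        refine Finset.expect_congr rfl fun z _ => ?_
        rw [← Finset.mul_expect]
        congr 1
        exact Fintype.expect_equiv (Equiv.subLeft z) _ _ fun _ => rfl
    _ = freq (Uncovered B C) ^ 2 := by
        rw [← Finset.expect_mul, sq]
        rfl

/-- If at most a fraction `y` of the space is uncovered by `C`, then `m` random generators leave
nothing uncovered, except with probability at most `m √y`: each new generator brings the fraction
from `y` down to `y ^ (3/2)`, which by Markov's inequality fails with probability at most
`y ^ 2 / y ^ (3/2) = √y`, and a fraction below `1 / |V|` is zero. -/
theorem freq_exists_uncovered_le (B : Finset V) (m : ℕ) (C : Submodule F V) {y : ℝ}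
    (hy0 : 0 < y) (hy1 : y ≤ 1) (hC : freq (Uncovered B C) ≤ y)
    (hm : y ^ ((3 / 2 : ℝ) ^ m) < 1 / Nat.card V) :
    freq (fun X : Fin m → V => ∃ z, Uncovered B (C ⊔ Submodule.span F (Set.range X)) z)
      ≤ m * y ^ (1 / 2 : ℝ) := by
  induction m generalizing C y with
  | zero =>
    have h0 : ∀ z, ¬ Uncovered B C z := not_of_freq_lt (hC.trans_lt (by simpa using hm))
    simp [freq, Set.range_eq_empty, h0]
  | succ m ih =>
    rw [← freq_equiv (Fin.consEquiv fun _ : Fin (m + 1) => V)]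
    have hpos : 0 < y ^ (3 / 2 : ℝ) := Real.rpow_pos_of_pos hy0 _
    have hbad : freq (fun x : V =>
        y ^ (3 / 2 : ℝ) < freq (Uncovered B (C ⊔ Submodule.span F {x}))) ≤ y ^ (1 / 2 : ℝ) := by
      refine (freq_lt_le_expect_div _ (fun x => freq_nonneg _) hpos).trans ?_
      rw [div_le_iff₀ hpos, ← Real.rpow_add hy0]
      refine (expect_freq_uncovered_sup_span_le B C).trans ?_
      calc freq (Uncovered B C) ^ 2 ≤ y ^ 2 := pow_le_pow_left₀ (freq_nonneg _) hC 2
        _ = y ^ (1 / 2 + 3 / 2 : ℝ) := by norm_num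
    refine (freq_prod_le _ _ (ε := m * y ^ (1 / 2 : ℝ)) (by positivity) fun x hx => ?_).trans
      ((add_le_add_left hbad _).trans_eq (by push_cast; ring))
    have h := ih (C ⊔ Submodule.span F {x}) hpos
      (Real.rpow_le_one hy0.le hy1 (by norm_num)) (not_lt.1 hx)
      (by rwa [← Real.rpow_mul hy0.le, ← pow_succ'])
    have hrange : ∀ X : Fin m → V, C ⊔ Submodule.span F (Set.range (Fin.cons x X : Fin (m + 1) → V))
        = C ⊔ Submodule.span F {x} ⊔ Submodule.span F (Set.range X) := by
      intro X
      rw [Fin.range_cons, Set.insert_eq, Submodule.span_union, sup_assoc]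
    simp only [Fin.consEquiv, Equiv.coe_fn_mk, hrange]
    refine h.trans (mul_le_mul_of_nonneg_left ?_ (Nat.cast_nonneg m))
    rw [← Real.rpow_mul hy0.le]
    exact Real.rpow_le_rpow_of_exponent_ge hy0 hy1 (by norm_num)

end Doubling

/-! ### Second moment of the number of covering codewords -/

section SecondMoment

theorem expect_mem {V : Type*} [Fintype V] [DecidableEq V] (B : Finset V) :
    𝔼 z : V, (if z ∈ B then (1 : ℝ) else 0) = B.card / Fintype.card V := by
  rw [Fintype.expect_eq_sum_div_card, Finset.sum_boole]
  simp

variable {F V : Type*} [Field F] [AddCommGroup V] [Module F V]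

/-- For a nonzero coefficient vector `u`, the combination `∑ i, u i • G i` of a uniformly random
family `G` is uniformly distributed. -/
theorem expect_linearCombination [Fintype V] {k : ℕ} {u : Fin k → F} (hu : u ≠ 0) (f : V → ℝ) :
    𝔼 G : Fin k → V, f (∑ i, u i • G i) = 𝔼 v, f v := by
  obtain ⟨i₀, hi₀⟩ := Function.ne_iff.1 hu
  -- Translating `G` in the coordinate `i₀` adds an arbitrary `v` to the combination.
  have shift : ∀ v : V, 𝔼 G : Fin k → V, f (∑ i, u i • G i)
      = 𝔼 G : Fin k → V, f (∑ i, u i • G i + v) := by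
    intro v
    rw [← expect_add_right (fun G : Fin k → V => f (∑ i, u i • G i))
      (Pi.single i₀ ((u i₀)⁻¹ • v))]
    refine Finset.expect_congr rfl fun G _ => ?_
    congr 1
    simp only [Pi.add_apply, smul_add, Finset.sum_add_distrib]
    congr 1
    rw [Finset.sum_eq_single i₀ (fun i _ hi => by simp [hi]) (by simp), Pi.single_eq_same,
      smul_inv_smul₀ hi₀]
  calc 𝔼 G : Fin k → V, f (∑ i, u i • G i)
      = 𝔼 v : V, 𝔼 G : Fin k → V, f (∑ i, u i • G i) := (Fintype.expect_const _).symm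
    _ = 𝔼 v : V, 𝔼 G : Fin k → V, f (∑ i, u i • G i + v) :=
        Finset.expect_congr rfl fun v _ => shift v
    _ = 𝔼 G : Fin k → V, 𝔼 v, f v := by
        rw [Finset.expect_comm]
        refine Finset.expect_congr rfl fun G _ => ?_
        simp only [add_comm _ (_ : V)]
        exact expect_add_right f _
    _ = 𝔼 v, f v := Fintype.expect_const _

open Classical in
/-- The number of coefficient vectors `u` for which the codeword `∑ i, u i • G i` covers `z`;
codewords are counted with multiplicity when the `G i` are linearly dependent. -/
noncomputable def coverCount [Fintype F] {k : ℕ} (B : Finset V) (G : Fin k → V) (z : V) : ℝ :=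
  ∑ u : Fin k → F, if z - ∑ i, u i • G i ∈ B then (1 : ℝ) else 0

/-- The mean number of codewords covering a vector, for codes with `k` generators. -/
noncomputable def meanCover (F : Type*) {V : Type*} [Fintype F] [Fintype V] (k : ℕ)
    (B : Finset V) : ℝ :=
  (Fintype.card F : ℝ) ^ k * B.card / Fintype.card V

variable [Fintype F] {k : ℕ} (B : Finset V)

theorem coverCount_eq_zero {G : Fin k → V} {z : V}
    (h : Uncovered B (Submodule.span F (Set.range G)) z) : coverCount (F := F) B G z = 0 := by
  refine Finset.sum_eq_zero fun u _ => if_neg (h _ ?_)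
  exact Submodule.sum_mem _ fun i _ =>
    Submodule.smul_mem _ _ (Submodule.subset_span (Set.mem_range_self i))

variable [Fintype V]

theorem expect_coverCount (G : Fin k → V) :
    𝔼 z, coverCount (F := F) B G z = meanCover F k B := by
  classical
  unfold coverCount
  rw [Finset.expect_sum_comm]
  have : ∀ u : Fin k → F, 𝔼 z : V, (if z - ∑ i, u i • G i ∈ B then (1 : ℝ) else 0)
      = B.card / Fintype.card V := by
    intro u
    rw [← expect_mem B]
    simp only [sub_eq_add_neg]
    exact expect_add_right (fun z => if z ∈ B then (1 : ℝ) else 0) _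
  simp only [this, Finset.sum_const, Finset.card_univ, Fintype.card_fun, Fintype.card_fin,
    nsmul_eq_mul, meanCover]
  push_cast
  ring

/-- As the code is linear, the second moment over `z` only involves the codewords themselves, not
pairs of them. -/
theorem expect_coverCount_sq [DecidableEq V] (G : Fin k → V) :
    𝔼 z, coverCount (F := F) B G z ^ 2 = (Fintype.card F : ℝ) ^ k *
      ∑ u : Fin k → F, 𝔼 z : V, (if z ∈ B then (1 : ℝ) else 0) *
        (if z - ∑ i, u i • G i ∈ B then (1 : ℝ) else 0) := by
  have expand : ∀ z, coverCount (F := F) B G z ^ 2 = ∑ u : Fin k → F, ∑ w : Fin k → F,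
      (if z - ∑ i, u i • G i ∈ B then (1 : ℝ) else 0) *
        (if z - ∑ i, u i • G i - ∑ i, w i • G i ∈ B then (1 : ℝ) else 0) := by
    intro z
    rw [sq, coverCount, Finset.sum_mul_sum]
    refine Finset.sum_congr rfl fun u _ => ?_
    rw [← Equiv.sum_comp (Equiv.addLeft u)]
    refine Finset.sum_congr rfl fun w _ => ?_
    simp only [Equiv.coe_addLeft, Pi.add_apply, add_smul, Finset.sum_add_distrib, sub_sub]
    congr
  simp only [expand]
  rw [Finset.expect_sum_comm]
  have inner : ∀ u : Fin k → F, 𝔼 z : V, ∑ w : Fin k → F,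
      (if z - ∑ i, u i • G i ∈ B then (1 : ℝ) else 0) *
        (if z - ∑ i, u i • G i - ∑ i, w i • G i ∈ B then (1 : ℝ) else 0)
      = ∑ u : Fin k → F, 𝔼 z : V, (if z ∈ B then (1 : ℝ) else 0) *
        (if z - ∑ i, u i • G i ∈ B then (1 : ℝ) else 0) := by
    intro u
    rw [← Finset.expect_sum_comm]
    exact Fintype.expect_equiv (Equiv.subRight (∑ i, u i • G i)) _ _ fun _ => rfl
  simp only [inner, Finset.sum_const, Finset.card_univ, Fintype.card_fun, Fintype.card_fin,
    nsmul_eq_mul]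
  push_cast
  rfl

theorem expect_expect_coverCount_sq_le (k : ℕ) :
    𝔼 G : Fin k → V, 𝔼 z, coverCount (F := F) B G z ^ 2
      ≤ meanCover F k B + meanCover F k B ^ 2 := by
  classical
  simp only [expect_coverCount_sq]
  rw [← Finset.mul_expect, Finset.expect_sum_comm]
  set b : ℝ := B.card / Fintype.card V with hb
  have hb0 : 0 ≤ b := by positivity
  have term : ∀ u : Fin k → F, 𝔼 G : Fin k → V, 𝔼 z : V, (if z ∈ B then (1 : ℝ) else 0) *
        (if z - ∑ i, u i • G i ∈ B then (1 : ℝ) else 0) ≤ (if u = 0 then b else 0) + b ^ 2 := by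
    intro u
    split_ifs with hu
    · refine le_add_of_le_of_nonneg ?_ (sq_nonneg b)
      refine Finset.expect_le Finset.univ_nonempty fun G _ => ?_
      rw [hb, ← expect_mem B]
      refine Finset.expect_le_expect fun z _ => ?_
      split_ifs <;> norm_num
    · rw [zero_add, Finset.expect_comm, sq]
      nth_rewrite 1 [hb]
      rw [← expect_mem B, Finset.expect_mul]
      refine Finset.expect_le_expect fun z _ => ?_
      rw [← Finset.mul_expect,
        expect_linearCombination hu (fun v => if z - v ∈ B then (1 : ℝ) else 0),
        hb, ← expect_mem B]
      refine le_of_eq ?_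
      congr 1
      exact Fintype.expect_equiv (Equiv.subLeft z) _ _ fun _ => rfl
  refine (mul_le_mul_of_nonneg_left (Finset.sum_le_sum fun u _ => term u)
    (by positivity)).trans_eq ?_
  rw [Finset.sum_add_distrib, Finset.sum_ite_eq' Finset.univ (0 : Fin k → F)]
  simp only [Finset.mem_univ, if_true, Finset.sum_const, Finset.card_univ, Fintype.card_fun,
    Fintype.card_fin, nsmul_eq_mul, meanCover, hb]
  push_cast
  ring

/-- Chebyshev's inequality over `z`, for a fixed code. -/
theorem freq_uncovered_mul_sq_le (G : Fin k → V) :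
    freq (Uncovered B (Submodule.span F (Set.range G))) * meanCover F k B ^ 2
      ≤ 𝔼 z, coverCount (F := F) B G z ^ 2 - meanCover F k B ^ 2 := by
  classical
  set μ := meanCover F k B with hμ
  have h : 𝔼 z, (coverCount (F := F) B G z - μ) ^ 2
      = 𝔼 z, coverCount (F := F) B G z ^ 2 - μ ^ 2 := by
    simp only [sub_sq, Finset.expect_add_distrib, Finset.expect_sub_distrib,
      Fintype.expect_const, ← Finset.expect_mul, ← Finset.mul_expect, expect_coverCount, ← hμ]
    ring
  rw [← h, freq, Finset.expect_mul]
  refine Finset.expect_le_expect fun z _ => ?_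
  split_ifs with hz
  · rw [coverCount_eq_zero B hz]
    simp
  · rw [zero_mul]
    exact sq_nonneg _

/-- The average uncovered fraction is at most the reciprocal of the mean cover count. -/
theorem expect_freq_uncovered_le (k : ℕ) (hμ : 0 < meanCover F k B) :
    𝔼 G : Fin k → V, freq (Uncovered B (Submodule.span F (Set.range G)))
      ≤ 1 / meanCover F k B := by
  have h : (𝔼 G : Fin k → V, freq (Uncovered B (Submodule.span F (Set.range G))))
      * meanCover F k B ^ 2 ≤ meanCover F k B := by
    rw [Finset.expect_mul]
    refine (Finset.expect_le_expect fun G _ => freq_uncovered_mul_sq_le B G).trans ?_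
    rw [Finset.expect_sub_distrib, Fintype.expect_const]
    linarith [expect_expect_coverCount_sq_le (F := F) B k]
  rw [le_div_iff₀ hμ]
  nlinarith

/-- A lower bound for the covered fraction, by the Cauchy–Schwarz inequality over `z`. -/
theorem sq_le_expect_coverCount_sq_mul_freq (G : Fin k → V) :
    meanCover F k B ^ 2 ≤ (𝔼 z, coverCount (F := F) B G z ^ 2) *
      freq (fun z => ¬ Uncovered B (Submodule.span F (Set.range G)) z) := by
  classical
  have h := Finset.expect_mul_sq_le_sq_mul_sq Finset.univ (fun z => coverCount (F := F) B G z)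
    (fun z => if ¬ Uncovered B (Submodule.span F (Set.range G)) z then (1 : ℝ) else 0)
  have h1 : ∀ z, coverCount (F := F) B G z *
      (if ¬ Uncovered B (Submodule.span F (Set.range G)) z then (1 : ℝ) else 0)
      = coverCount (F := F) B G z := by
    intro z
    by_cases hz : Uncovered B (Submodule.span F (Set.range G)) z
    · simp [coverCount_eq_zero B hz]
    · simp [hz]
  simp only [h1, expect_coverCount, ite_pow, one_pow, ne_eq, OfNat.ofNat_ne_zero,
    not_false_eq_true, zero_pow] at h
  refine h.trans_eq ?_
  congr 1
  exact Finset.expect_congr rfl fun z _ => by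
    by_cases hz : Uncovered B (Submodule.span F (Set.range G)) z <;> simp [hz]

end SecondMoment

/-! ### Probability that a random code fails to cover -/

section Failure

variable {F V : Type*} [Field F] [Fintype F] [AddCommGroup V] [Module F V] [Fintype V]

theorem expect_coverCount_sq_nonneg {k : ℕ} (B : Finset V) (G : Fin k → V) :
    0 ≤ 𝔼 z, coverCount (F := F) B G z ^ 2 :=
  Finset.expect_nonneg fun _ _ => sq_nonneg _

theorem meanCover_mono {F V : Type*} [Field F] [Fintype F] [Fintype V] (B : Finset V) {k l : ℕ}
    (h : k ≤ l) :
    meanCover F k B ≤ meanCover F l B := by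
  unfold meanCover
  have hq : (1 : ℝ) ≤ Fintype.card F := by exact_mod_cast Fintype.card_pos
  gcongr

/-- With `μ` the mean cover count, the covered fraction is at least `μ / (t (1 + μ))`, except with
probability at most `1 / t`. This bound serves codes that cover a small part of the space. -/
theorem freq_freq_covered_lt_le (B : Finset V) (k : ℕ) (hμ : 0 < meanCover F k B) {t : ℝ}
    (ht : 0 < t) :
    freq (fun G : Fin k → V =>
        freq (fun z => ¬ Uncovered B (Submodule.span F (Set.range G)) z)
          < meanCover F k B / (t * (1 + meanCover F k B))) ≤ 1 / t := by
  set μ := meanCover F k B with hμdef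
  have hpos : 0 < t * (μ + μ ^ 2) := by positivity
  have hmarkov := freq_lt_le_expect_div (fun G : Fin k → V => 𝔼 z, coverCount (F := F) B G z ^ 2)
    (expect_coverCount_sq_nonneg B) hpos
  refine (freq_mono fun G hG => ?_).trans (hmarkov.trans ?_)
  · have hcs := sq_le_expect_coverCount_sq_mul_freq (F := F) B G
    have h0 := expect_coverCount_sq_nonneg (F := F) B G
    rw [← hμdef] at hcs
    by_contra! hle
    have hlt : (𝔼 z, coverCount (F := F) B G z ^ 2) *
        freq (fun z => ¬ Uncovered B (Submodule.span F (Set.range G)) z) < μ ^ 2 := by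
      rcases h0.eq_or_lt with h0 | h0
      · rw [← h0, zero_mul]
        positivity
      · calc _ < (𝔼 z, coverCount (F := F) B G z ^ 2) * (μ / (t * (1 + μ))) :=
              mul_lt_mul_of_pos_left hG h0
          _ ≤ t * (μ + μ ^ 2) * (μ / (t * (1 + μ))) :=
              mul_le_mul_of_nonneg_right hle (by positivity)
          _ = μ ^ 2 := by
              field_simp
    exact absurd hcs (not_le.2 hlt)
  · rw [div_le_div_iff₀ hpos ht]
    have := expect_expect_coverCount_sq_le (F := F) B k
    rw [← hμdef] at this
    nlinarith

/-- A code with `k + m` random generators covers the whole space, except with the probability that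
the first `k` generators leave more than a fraction `y` uncovered, or the last `m` ones do not
finish the covering. -/
theorem freq_exists_uncovered_add_le (B : Finset V) (k m : ℕ) (hμ : 0 < meanCover F k B) {y : ℝ}
    (hy0 : 0 < y) (hy1 : y ≤ 1) (hm : y ^ ((3 / 2 : ℝ) ^ m) < 1 / Nat.card V) :
    freq (fun G : Fin (k + m) → V => ∃ z, Uncovered B (Submodule.span F (Set.range G)) z)
      ≤ 1 / meanCover F k B / y + m * y ^ (1 / 2 : ℝ) := by
  rw [← freq_equiv (Fin.appendEquiv k m)]
  refine (freq_prod_le _ (fun G : Fin k → V =>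
    y < freq (Uncovered B (Submodule.span F (Set.range G)))) (ε := m * y ^ (1 / 2 : ℝ))
    (by positivity) fun G hG => ?_).trans (add_le_add_left ?_ _)
  · refine (freq_mono fun X hX => ?_).trans
      (freq_exists_uncovered_le B m (Submodule.span F (Set.range G)) hy0 hy1 (not_lt.1 hG) hm)
    obtain ⟨z, hz⟩ := hX
    refine ⟨z, hz.anti ?_⟩
    rw [← Submodule.span_union]
    refine Submodule.span_mono (Set.union_subset ?_ ?_)
    · rintro _ ⟨i, rfl⟩
      exact ⟨Fin.castAdd m i, Fin.append_left _ _ i⟩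
    · rintro _ ⟨i, rfl⟩
      exact ⟨Fin.natAdd k i, Fin.append_right _ _ i⟩
  · refine (freq_lt_le_expect_div _ (fun _ => freq_nonneg _) hy0).trans ?_
    exact div_le_div_of_nonneg_right (expect_freq_uncovered_le B k hμ) hy0.le

end Failure

/-! ### Partial covering codes -/

section PartialCovering

theorem generatedCode_eq_span {F : Type*} [Field F] {k n : ℕ} (G : Fin k → Fin n → F) :
    generatedCode (Matrix.of G) = Submodule.span F (Set.range G) :=
  range_vecMulLinear _

variable {F : Type*} [Field F] [Fintype F] [DecidableEq F]

/-- The Hamming ball of radius `ρ n` around the origin of `F ^ n`. -/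
noncomputable def hammingBall (F : Type*) [Field F] [Fintype F] [DecidableEq F] (n : ℕ) (ρ : ℝ) :
    Finset (Fin n → F) :=
  {z | (hammingNorm z : ℝ) ≤ ρ * n}

/-- A code is partial covering as soon as the fraction of the space that it covers is large
enough; the rounding in the definition is harmless, the number of covered vectors being an
integer. -/
theorem isPartialCovering_of_le_freq {n : ℕ} {ρ τ : ℝ} {C : Submodule F (Fin n → F)}
    (h : (Fintype.card F : ℝ) ^ (-((n : ℝ) * τ)) ≤
      freq (fun z => ¬ Uncovered (hammingBall F n ρ) C z)) :
    IsPartialCovering ρ τ (C : Set (Fin n → F)) := by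
  classical
  have hq : (0 : ℝ) < Fintype.card F := by exact_mod_cast Fintype.card_pos
  have hcard : ⌈(Fintype.card F : ℝ) ^ ((n : ℝ) * (1 - τ))⌉₊ ≤
      (Finset.univ.filter fun z => ¬ Uncovered (hammingBall F n ρ) C z).card := by
    rw [Nat.ceil_le]
    have hexp : (n : ℝ) * (1 - τ) = -((n : ℝ) * τ) + n := by ring
    rw [hexp, Real.rpow_add hq, Real.rpow_natCast, ← le_div_iff₀ (by positivity)]
    rwa [freq_eq_card_div, Nat.card_eq_fintype_card, Nat.card_eq_fintype_card,
      Fintype.card_subtype, Fintype.card_fun, Fintype.card_fin, Nat.cast_pow] at h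
  obtain ⟨X, hX, hXcard⟩ := Finset.exists_subset_card_eq hcard
  refine ⟨X, hXcard, fun x hx => ?_⟩
  have hx' := (Finset.mem_filter.1 (hX hx)).2
  unfold Uncovered at hx'
  push Not at hx'
  obtain ⟨c, hc, hcB⟩ := hx'
  refine ⟨c, hc, ?_⟩
  rw [hammingDist_comm, hammingDist_eq_hammingNorm, neg_add_eq_sub]
  exact (Finset.mem_filter.1 hcB).2

theorem isPartialCovering_of_forall {n : ℕ} {ρ τ : ℝ} (hτ : 0 ≤ τ)
    {C : Submodule F (Fin n → F)} (h : ∀ z, ¬ Uncovered (hammingBall F n ρ) C z) :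
    IsPartialCovering ρ τ (C : Set (Fin n → F)) := by
  refine isPartialCovering_of_le_freq ?_
  have h1 : freq (fun z => ¬ Uncovered (hammingBall F n ρ) C z) = 1 := by
    simp [freq, h]
  rw [h1]
  have hq : (1 : ℝ) ≤ Fintype.card F := by exact_mod_cast Fintype.card_pos
  exact Real.rpow_le_one_of_one_le_of_nonpos hq (neg_nonpos.2 (by positivity))

theorem partialCoveringFraction_eq_one_sub_freq (k n : ℕ) (ρ τ : ℝ) :
    partialCoveringFraction F k n ρ τ = 1 - freq (fun G : Fin k → Fin n → F =>
      ¬ IsPartialCovering ρ τ (Submodule.span F (Set.range G) : Set (Fin n → F))) := by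
  rw [freq_not, sub_sub_cancel, freq_eq_card_div]
  unfold partialCoveringFraction
  congr 3
  simp only [← generatedCode_eq_span]
  rfl

theorem partialCoveringFraction_le_one (k n : ℕ) (ρ τ : ℝ) :
    partialCoveringFraction F k n ρ τ ≤ 1 := by
  rw [partialCoveringFraction_eq_one_sub_freq]
  linarith [freq_nonneg (fun G : Fin k → Fin n → F =>
      ¬ IsPartialCovering ρ τ (Submodule.span F (Set.range G) : Set (Fin n → F)))]

/-- If `k` random generators cover each vector `n ^ 5 q ^ (-n τ)` times on average, then `m` more
of them make the code `(ρ, τ)`-partial covering with probability at least `1 - (m + 1) / n`. When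
`q ^ (-n τ)` is at most `n ^ (-2)`, the Cauchy–Schwarz bound for the covered fraction suffices;
otherwise the mean cover count exceeds `n ^ 3`, the uncovered fraction is likely to be at most
`n ^ (-2)`, and the last `m` generators bring it to zero. -/
theorem one_sub_div_le_partialCoveringFraction {k m n : ℕ} {ρ τ : ℝ} (hn : 2 ≤ n) (hτ : 0 ≤ τ)
    (hk : (n : ℝ) ^ 5 * (Fintype.card F : ℝ) ^ (-((n : ℝ) * τ))
      ≤ meanCover F k (hammingBall F n ρ))
    (hm : (((n : ℝ) ^ 2)⁻¹) ^ ((3 / 2 : ℝ) ^ m) < 1 / (Fintype.card F : ℝ) ^ n) :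
    1 - (m + 1 : ℝ) / n ≤ partialCoveringFraction F (k + m) n ρ τ := by
  rw [partialCoveringFraction_eq_one_sub_freq]
  refine sub_le_sub_left ?_ 1
  set s : ℝ := (Fintype.card F : ℝ) ^ (-((n : ℝ) * τ)) with hs
  have hq : (0 : ℝ) < Fintype.card F := by exact_mod_cast Fintype.card_pos
  have hs0 : 0 < s := Real.rpow_pos_of_pos hq _
  have hn2 : (2 : ℝ) ≤ n := by exact_mod_cast hn
  have hn0 : (0 : ℝ) < n := by linarith
  set B := hammingBall F n ρ
  have hμ0 : 0 < meanCover F k B := lt_of_lt_of_le (by positivity) hk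
  have h1n : 1 / (n : ℝ) ≤ (m + 1 : ℝ) / n :=
    div_le_div_of_nonneg_right (by linarith [Nat.cast_nonneg (α := ℝ) m]) hn0.le
  rcases le_or_gt s (((n : ℝ) ^ 2)⁻¹) with hsmall | hlarge
  · have hmono : meanCover F k B ≤ meanCover F (k + m) B := meanCover_mono B (Nat.le_add_right k m)
    set μ := meanCover F (k + m) B
    have hμ : 0 < μ := hμ0.trans_le hmono
    refine (freq_mono fun G hG => ?_).trans
      ((freq_freq_covered_lt_le (F := F) B (k + m) hμ hn0).trans h1n)
    by_contra! hle
    refine hG (isPartialCovering_of_le_freq (le_trans ?_ hle))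
    rw [← hs, le_div_iff₀ (by positivity)]
    have h1 : s * n * n ≤ 1 := by
      calc s * n * n = s * (n : ℝ) ^ 2 := by ring
        _ ≤ ((n : ℝ) ^ 2)⁻¹ * (n : ℝ) ^ 2 := by gcongr
        _ = 1 := inv_mul_cancel₀ (by positivity)
    have h2 : s * n ≤ 1 / 2 := by nlinarith [mul_pos hs0 hn0]
    have h3 : (n : ℝ) ^ 4 * (s * n) ≤ μ := by
      calc (n : ℝ) ^ 4 * (s * n) = (n : ℝ) ^ 5 * s := by ring
        _ ≤ μ := hk.trans hmono
    have h4 : (2 : ℝ) ≤ (n : ℝ) ^ 4 := by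
      calc (2 : ℝ) ≤ 2 ^ 4 := by norm_num
        _ ≤ (n : ℝ) ^ 4 := by gcongr
    have h5 : 2 * (s * n) ≤ μ := (mul_le_mul_of_nonneg_right h4 (by positivity)).trans h3
    calc s * (n * (1 + μ)) = s * n + s * n * μ := by ring
      _ ≤ μ / 2 + 1 / 2 * μ := by gcongr; linarith
      _ = μ := by ring
  · have hμ : (n : ℝ) ^ 3 ≤ meanCover F k B := by
      calc (n : ℝ) ^ 3 = (n : ℝ) ^ 5 * ((n : ℝ) ^ 2)⁻¹ := by field_simp
        _ ≤ (n : ℝ) ^ 5 * s := by gcongr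
        _ ≤ _ := hk
    have hy1 : ((n : ℝ) ^ 2)⁻¹ ≤ 1 := inv_le_one_of_one_le₀ (one_le_pow₀ (by linarith))
    refine (freq_mono fun G hG => ?_).trans
      ((freq_exists_uncovered_add_le (F := F) B k m hμ0 (y := ((n : ℝ) ^ 2)⁻¹) (by positivity) hy1
        ?_).trans ?_)
    · by_contra! h
      exact hG (isPartialCovering_of_forall hτ h)
    · simpa [Nat.card_eq_fintype_card] using hm
    · have hsqrt : (((n : ℝ) ^ 2)⁻¹) ^ (1 / 2 : ℝ) = 1 / n := by
        rw [← Real.sqrt_eq_rpow, Real.sqrt_inv, Real.sqrt_sq hn0.le, one_div]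
      rw [hsqrt, div_inv_eq_mul]
      have : 1 / meanCover F k B * (n : ℝ) ^ 2 ≤ 1 / (n : ℝ) := by
        calc 1 / meanCover F k B * (n : ℝ) ^ 2 ≤ 1 / (n : ℝ) ^ 3 * (n : ℝ) ^ 2 := by gcongr
          _ = 1 / (n : ℝ) := by field_simp
      calc _ ≤ 1 / (n : ℝ) + m * (1 / n) := by gcongr
        _ = (m + 1 : ℝ) / n := by ring

end PartialCovering

/-! ### The volume of a Hamming ball -/

section Volume

theorem choose_mul_pow_le_card_hammingBall (F : Type*) [Field F] [Fintype F] [DecidableEq F]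
    {n r : ℕ} {ρ : ℝ} (hr : (r : ℝ) ≤ ρ * n) :
    n.choose r * (Fintype.card F - 1) ^ r ≤ (hammingBall F n ρ).card := by
  classical
  set T : Finset (Fin n → F) := {z | hammingNorm z = r} with hT
  have hTB : T ⊆ hammingBall F n ρ := by
    intro z hz
    rw [hT, Finset.mem_filter] at hz
    rw [hammingBall, Finset.mem_filter, hz.2]
    exact ⟨Finset.mem_univ z, hr⟩
  refine le_trans ?_ (Finset.card_le_card hTB)
  have hmaps : Set.MapsTo (fun z : Fin n → F => ({i | z i ≠ 0} : Finset (Fin n))) T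
      (Finset.powersetCard r (Finset.univ : Finset (Fin n))) := by
    intro z hz
    rw [hT, Finset.mem_coe, Finset.mem_filter] at hz
    exact Finset.mem_coe.2 (Finset.mem_powersetCard.2 ⟨Finset.subset_univ _, hz.2⟩)
  rw [Finset.card_eq_sum_card_fiberwise hmaps]
  have hfib : ∀ s ∈ Finset.powersetCard r (Finset.univ : Finset (Fin n)),
      (Fintype.card F - 1) ^ r ≤ (T.filter fun z => ({i | z i ≠ 0} : Finset (Fin n)) = s).card := by
    intro s hs
    have hsr := (Finset.mem_powersetCard.1 hs).2
    have hpi : (Fintype.piFinset fun i => if i ∈ s then ({0}ᶜ : Finset F) else {0}).card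
        = (Fintype.card F - 1) ^ r := by
      rw [Fintype.card_piFinset]
      simp only [apply_ite Finset.card, Finset.card_compl, Finset.card_singleton]
      rw [Finset.prod_ite_mem, Finset.univ_inter, Finset.prod_const, hsr]
    rw [← hpi]
    refine Finset.card_le_card fun z hz => ?_
    rw [Fintype.mem_piFinset] at hz
    have hsupp : ({i | z i ≠ 0} : Finset (Fin n)) = s := by
      ext i
      have := hz i
      by_cases hi : i ∈ s <;> simp_all
    rw [Finset.mem_filter, hT, Finset.mem_filter]
    exact ⟨⟨Finset.mem_univ z, (congrArg Finset.card hsupp).trans hsr⟩, hsupp⟩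
  calc n.choose r * (Fintype.card F - 1) ^ r
      = ∑ s ∈ Finset.powersetCard r (Finset.univ : Finset (Fin n)), (Fintype.card F - 1) ^ r := by
        rw [Finset.sum_const, Finset.card_powersetCard, Finset.card_univ, Fintype.card_fin,
          smul_eq_mul]
    _ ≤ _ := Finset.sum_le_sum hfib

/-- The binomial probability of the value `⌊ρ n⌋`, at distance less than one from the mean, is at
least `(1 - ρ) / (n + 1)`: up to the factor `1 - ρ` it is the largest of `n + 1` probabilities
with sum `1`. -/
theorem le_binomial_floor {ρ : ℝ} (h0 : 0 < ρ) (h1 : ρ < 1) (n : ℕ) :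
    (1 - ρ) / (n + 1) ≤
      n.choose ⌊ρ * n⌋₊ * ρ ^ ⌊ρ * n⌋₊ * (1 - ρ) ^ (n - ⌊ρ * n⌋₊) := by
  have hσ : 0 < 1 - ρ := sub_pos.2 h1
  set r := ⌊ρ * n⌋₊ with hr
  have hrle : (r : ℝ) ≤ ρ * n := Nat.floor_le (by positivity)
  have hrlt : ρ * n < r + 1 := Nat.lt_floor_add_one _
  set t : ℕ → ℝ := fun j => n.choose j * ρ ^ j * (1 - ρ) ^ (n - j) with ht
  have ht0 : ∀ j, 0 ≤ t j := fun j => by positivity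
  have hrec : ∀ j, j < n → t (j + 1) * ((j + 1) * (1 - ρ)) = t j * ((n - j) * ρ) := by
    intro j hj
    have hc : (n.choose (j + 1) : ℝ) * (j + 1) = n.choose j * (n - j) := by
      have := Nat.choose_succ_right_eq n j
      rw [← Nat.cast_sub hj.le]
      exact_mod_cast this
    have hp : (1 - ρ) ^ (n - j) = (1 - ρ) ^ (n - (j + 1)) * (1 - ρ) := by
      rw [← pow_succ]
      congr 1
      omega
    simp only [ht]
    rw [hp, pow_succ]
    linear_combination ρ ^ j * ρ * (1 - ρ) ^ (n - (j + 1)) * (1 - ρ) * hc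
  have hup : ∀ j, j ≤ r → t j ≤ t r := by
    intro j hj
    refine Nat.decreasingInduction' (P := fun j => t j ≤ t r) (fun i hi _ ih => ?_) hj le_rfl
    refine le_trans ?_ ih
    have hir : (i : ℝ) + 1 ≤ r := by exact_mod_cast hi
    have hin : i < n := by
      have : (i : ℝ) < n := by nlinarith [Nat.cast_nonneg (α := ℝ) n]
      exact_mod_cast this
    have hpos : 0 < ((i : ℝ) + 1) * (1 - ρ) := by positivity
    refine le_of_mul_le_mul_right ?_ hpos
    rw [hrec i hin]
    exact mul_le_mul_of_nonneg_left (by nlinarith) (ht0 i)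
  have hdown : ∀ j, r + 1 ≤ j → t j ≤ t (r + 1) := by
    intro j hj
    induction j, hj using Nat.le_induction with
    | base => exact le_rfl
    | succ i hi ih =>
      refine le_trans ?_ ih
      rcases lt_or_ge i n with hin | hin
      · have hir : (r : ℝ) + 1 ≤ i := by exact_mod_cast hi
        have hpos : 0 < ((i : ℝ) + 1) * (1 - ρ) := by positivity
        refine le_of_mul_le_mul_right ?_ hpos
        rw [hrec i hin]
        exact mul_le_mul_of_nonneg_left (by nlinarith) (ht0 i)
      · have : t (i + 1) = 0 := by simp [ht, Nat.choose_eq_zero_of_lt (Nat.lt_succ_of_le hin)]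
        rw [this]
        exact ht0 i
  have hnext : (1 - ρ) * t (r + 1) ≤ t r := by
    rcases lt_or_ge r n with hrn | hrn
    · have hpos : 0 < (r : ℝ) + 1 := by positivity
      refine le_of_mul_le_mul_right ?_ hpos
      calc (1 - ρ) * t (r + 1) * (r + 1) = t (r + 1) * ((r + 1) * (1 - ρ)) := by ring
        _ = t r * ((n - r) * ρ) := hrec r hrn
        _ ≤ t r * (r + 1) :=
          mul_le_mul_of_nonneg_left (by nlinarith [Nat.cast_nonneg (α := ℝ) r]) (ht0 r)
    · have : t (r + 1) = 0 := by simp [ht, Nat.choose_eq_zero_of_lt (Nat.lt_succ_of_le hrn)]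
      rw [this, mul_zero]
      exact ht0 r
  have hall : ∀ j, (1 - ρ) * t j ≤ t r := by
    intro j
    rcases le_or_gt j r with hj | hj
    · calc (1 - ρ) * t j ≤ 1 * t j := mul_le_mul_of_nonneg_right (by linarith) (ht0 j)
        _ = t j := one_mul _
        _ ≤ t r := hup j hj
    · exact (mul_le_mul_of_nonneg_left (hdown j hj) hσ.le).trans hnext
  have hsum : ∑ j ∈ Finset.range (n + 1), t j = 1 := by
    have h := add_pow ρ (1 - ρ) n
    rw [add_sub_cancel, one_pow] at h
    rw [h]
    exact Finset.sum_congr rfl fun j _ => by simp only [ht]; ring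
  rw [div_le_iff₀ (by positivity)]
  calc (1 - ρ) = ∑ j ∈ Finset.range (n + 1), (1 - ρ) * t j := by
        rw [← Finset.mul_sum, hsum, mul_one]
    _ ≤ ∑ _j ∈ Finset.range (n + 1), t r := Finset.sum_le_sum fun j _ => hall j
    _ = t r * (n + 1) := by
        rw [Finset.sum_const, Finset.card_range, nsmul_eq_mul]
        push_cast
        ring

/-- `q ^ (n H_q(ρ)) = λ ^ (-ρ n) (1 - ρ) ^ (-n)` with `λ = ρ / ((q - 1) (1 - ρ))`. -/
theorem rpow_mul_entropyBase {q : ℕ} (hq : 2 ≤ q) {ρ : ℝ} (h0 : 0 < ρ) (h1 : ρ < 1) (n : ℕ) :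
    (q : ℝ) ^ ((n : ℝ) * entropyBase q ρ)
      = (ρ / ((q - 1) * (1 - ρ))) ^ (-(ρ * n)) * (1 - ρ) ^ (-(n : ℝ)) := by
  have hq2 : (2 : ℝ) ≤ q := by exact_mod_cast hq
  have hq1 : (0 : ℝ) < (q : ℝ) - 1 := by linarith
  have hσ : 0 < 1 - ρ := sub_pos.2 h1
  have hlogq : Real.log q ≠ 0 := (Real.log_pos (by linarith)).ne'
  rw [Real.rpow_def_of_pos (by linarith), Real.rpow_def_of_pos (by positivity),
    Real.rpow_def_of_pos hσ, ← Real.exp_add, Real.log_div h0.ne' (by positivity),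
    Real.log_mul hq1.ne' hσ.ne']
  congr 1
  rw [entropyBase_eq]
  unfold Real.logb
  field_simp
  ring

/-- The ball of radius `ρ n` has volume `q ^ (n H_q(ρ))` up to a factor linear in `n`. -/
theorem le_card_hammingBall (F : Type*) [Field F] [Fintype F] [DecidableEq F] {ρ : ℝ}
    (h0 : 0 < ρ) (hle : ρ ≤ 1 - 1 / (Fintype.card F : ℝ)) (n : ℕ) :
    ρ / ((Fintype.card F - 1) * (n + 1)) *
        (Fintype.card F : ℝ) ^ ((n : ℝ) * entropyBase (Fintype.card F) ρ)
      ≤ (hammingBall F n ρ).card := by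
  have hq : 2 ≤ Fintype.card F := Fintype.one_lt_card
  have hvol := choose_mul_pow_le_card_hammingBall F (n := n) (ρ := ρ)
    (Nat.floor_le (by positivity))
  set q := Fintype.card F
  have hq2 : (2 : ℝ) ≤ q := by exact_mod_cast hq
  have hq1 : (0 : ℝ) < (q : ℝ) - 1 := by linarith
  have hqσ : 1 / (q : ℝ) ≤ 1 - ρ := by linarith
  have hσ : 0 < 1 - ρ := lt_of_lt_of_le (by positivity) hqσ
  have h1 : ρ < 1 := by linarith
  set l : ℝ := ρ / ((q - 1) * (1 - ρ)) with hl
  have hl0 : 0 < l := by positivity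
  have hl1 : l ≤ 1 := by
    rw [hl, div_le_one (by positivity)]
    have : 1 ≤ (q : ℝ) * (1 - ρ) := by
      rw [div_le_iff₀ (by linarith)] at hqσ
      linarith
    linarith
  have hbin := le_binomial_floor h0 h1 n
  have hrn : ⌊ρ * n⌋₊ ≤ n := Nat.floor_le_of_le (by nlinarith [Nat.cast_nonneg (α := ℝ) n])
  have hrlt : ρ * n < ⌊ρ * n⌋₊ + 1 := Nat.lt_floor_add_one _
  set r := ⌊ρ * n⌋₊
  have hvol' : (n.choose r : ℝ) * ((q : ℝ) - 1) ^ r ≤ (hammingBall F n ρ).card := by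
    have h : (n.choose r : ℝ) * ((q - 1 : ℕ) : ℝ) ^ r ≤ (hammingBall F n ρ).card := by
      exact_mod_cast hvol
    rwa [Nat.cast_sub (by omega), Nat.cast_one] at h
  refine le_trans ?_ hvol'
  have hterm : (n.choose r : ℝ) * ρ ^ r * (1 - ρ) ^ (n - r)
      = n.choose r * ((q : ℝ) - 1) ^ r * (l ^ r * (1 - ρ) ^ n) := by
    have hρ : ρ = (q - 1) * l * (1 - ρ) := by
      rw [hl]
      field_simp
    have hpow : (1 - ρ) ^ n = (1 - ρ) ^ r * (1 - ρ) ^ (n - r) := by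
      rw [← pow_add, Nat.add_sub_cancel' hrn]
    calc (n.choose r : ℝ) * ρ ^ r * (1 - ρ) ^ (n - r)
        = n.choose r * ((q - 1) * l * (1 - ρ)) ^ r * (1 - ρ) ^ (n - r) := by rw [← hρ]
      _ = _ := by
        rw [hpow, mul_pow, mul_pow]
        ring
  rw [hterm] at hbin
  rw [rpow_mul_entropyBase hq h0 h1]
  have hle_l : l ^ r ≤ l ^ (ρ * n) * l⁻¹ := by
    rw [← Real.rpow_natCast, ← Real.rpow_neg_one l, ← Real.rpow_add hl0]
    exact Real.rpow_le_rpow_of_exponent_ge hl0 hl1 (by linarith)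
  have hlρ : ρ / (q - 1) = l * (1 - ρ) := by
    rw [hl]
    field_simp
  rw [Real.rpow_neg hl0.le, Real.rpow_neg hσ.le, Real.rpow_natCast]
  have hP : 0 < l ^ (ρ * n) := Real.rpow_pos_of_pos hl0 _
  have hS : 0 < (1 - ρ) ^ n := by positivity
  rw [← div_div, hlρ]
  have hkey : (1 - ρ) / (n + 1) ≤
      n.choose r * ((q : ℝ) - 1) ^ r * (l ^ (ρ * n) * l⁻¹ * (1 - ρ) ^ n) :=
    hbin.trans (by gcongr)
  calc l * (1 - ρ) / (n + 1) * ((l ^ (ρ * n))⁻¹ * ((1 - ρ) ^ n)⁻¹)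
      = (1 - ρ) / (n + 1) * (l * (l ^ (ρ * n))⁻¹ * ((1 - ρ) ^ n)⁻¹) := by ring
    _ ≤ n.choose r * ((q : ℝ) - 1) ^ r * (l ^ (ρ * n) * l⁻¹ * (1 - ρ) ^ n) *
        (l * (l ^ (ρ * n))⁻¹ * ((1 - ρ) ^ n)⁻¹) := by gcongr
    _ = n.choose r * ((q : ℝ) - 1) ^ r := by field_simp

end Volume

/-! ### Choice of the parameters -/

section Asymptotics

/-- The number of extra generators used to complete a covering of `F ^ n`. -/
def extraGenerators (n : ℕ) : ℕ := 2 * (Nat.log 2 n + 1)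

theorem lt_rpow_extraGenerators (n : ℕ) : (n : ℝ) < (3 / 2 : ℝ) ^ extraGenerators n := by
  have h : n < 2 ^ (Nat.log 2 n + 1) := Nat.lt_pow_succ_log_self one_lt_two n
  calc (n : ℝ) < (2 : ℝ) ^ (Nat.log 2 n + 1) := by exact_mod_cast h
    _ ≤ ((3 / 2 : ℝ) ^ 2) ^ (Nat.log 2 n + 1) := by gcongr; norm_num
    _ = (3 / 2 : ℝ) ^ extraGenerators n := by rw [← pow_mul, extraGenerators]

theorem rpow_extraGenerators_lt {q n : ℕ} (hq : 2 ≤ q) (hn : q ≤ n) :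
    (((n : ℝ) ^ 2)⁻¹) ^ ((3 / 2 : ℝ) ^ extraGenerators n) < 1 / (q : ℝ) ^ n := by
  have hq2 : (2 : ℝ) ≤ q := by exact_mod_cast hq
  have hqn : (q : ℝ) ≤ n := by exact_mod_cast hn
  have hinv : ((n : ℝ) ^ 2)⁻¹ ≤ (q : ℝ)⁻¹ := by
    gcongr
    nlinarith
  have hq0 : (0 : ℝ) < (q : ℝ)⁻¹ := by positivity
  have hq1 : (q : ℝ)⁻¹ < 1 := inv_lt_one_of_one_lt₀ (by linarith)
  calc _ ≤ ((q : ℝ)⁻¹) ^ ((3 / 2 : ℝ) ^ extraGenerators n) :=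
        Real.rpow_le_rpow (by positivity) hinv (by positivity)
    _ < ((q : ℝ)⁻¹) ^ (n : ℝ) :=
        Real.rpow_lt_rpow_of_exponent_gt hq0 hq1 (lt_rpow_extraGenerators n)
    _ = 1 / (q : ℝ) ^ n := by rw [Real.rpow_natCast, inv_pow, one_div]

theorem pow_extraGenerators_le {q n : ℕ} (hn : n ≠ 0) :
    q ^ extraGenerators n ≤ q ^ 2 * n ^ (2 * q) := by
  have h1 : q ^ Nat.log 2 n ≤ n ^ q := by
    calc q ^ Nat.log 2 n ≤ (2 ^ q) ^ Nat.log 2 n :=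
          Nat.pow_le_pow_left Nat.lt_two_pow_self.le _
      _ = (2 ^ Nat.log 2 n) ^ q := by rw [← pow_mul, mul_comm, pow_mul]
      _ ≤ n ^ q := Nat.pow_le_pow_left (Nat.pow_log_le_self 2 hn) q
  calc q ^ extraGenerators n = q ^ 2 * (q ^ Nat.log 2 n) ^ 2 := by
        rw [extraGenerators]
        ring
    _ ≤ q ^ 2 * (n ^ q) ^ 2 := by gcongr
    _ = q ^ 2 * n ^ (2 * q) := by ring

theorem tendsto_logb_div (b : ℝ) :
    Tendsto (fun n : ℕ => Real.logb b n / n) atTop (𝓝 0) := by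
  have h1 := (Real.isLittleO_log_id_atTop.tendsto_div_nhds_zero.comp
    (tendsto_natCast_atTop_atTop (R := ℝ))).div_const (Real.log b)
  rw [zero_div] at h1
  refine h1.congr fun n => ?_
  simp only [Function.comp_apply, id_eq, Real.logb]
  ring

theorem tendsto_natLog_div : Tendsto (fun n : ℕ => (Nat.log 2 n : ℝ) / n) atTop (𝓝 0) := by
  refine squeeze_zero (fun n => by positivity) (fun n => ?_) (tendsto_logb_div 2)
  exact div_le_div_of_nonneg_right (Real.natLog_le_logb n 2) (Nat.cast_nonneg n)

theorem tendsto_extraGenerators_add_one_div :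
    Tendsto (fun n : ℕ => (extraGenerators n + 1 : ℝ) / n) atTop (𝓝 0) := by
  have h := (tendsto_natLog_div.const_mul 2).add
    ((tendsto_inv_atTop_nhds_zero_nat (𝕜 := ℝ)).const_mul 3)
  simp only [mul_zero, add_zero] at h
  refine h.congr fun n => ?_
  rw [extraGenerators]
  push_cast
  ring

variable {F : Type*} [Field F] [Fintype F] [DecidableEq F]

/-- For all large `n`, uniformly in `τ`, codes whose dimension parameter exceeds
`n (1 - τ - H_q(ρ))` by a fixed multiple of `log_q n` fail to be `(ρ, τ)`-partial covering with
probability `O(log n / n)`. -/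
theorem eventually_le_partialCoveringFraction {ρ : ℝ} (h0 : 0 < ρ)
    (hle : ρ ≤ 1 - 1 / (Fintype.card F : ℝ)) :
    ∀ᶠ n : ℕ in atTop, ∀ (τ : ℝ) (k : ℕ), 0 ≤ τ → τ ≤ 1 - entropyBase (Fintype.card F) ρ →
      n * (1 - τ - entropyBase (Fintype.card F) ρ) +
        (8 + 2 * Fintype.card F : ℕ) * Real.logb (Fintype.card F) n ≤ k →
      1 - (extraGenerators n + 1 : ℝ) / n ≤ partialCoveringFraction F k n ρ τ := by
  have hq : 2 ≤ Fintype.card F := Fintype.one_lt_card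
  have hvol := le_card_hammingBall F h0 hle
  have hmain := fun k m n τ => one_sub_div_le_partialCoveringFraction (F := F) (k := k) (m := m)
    (n := n) (ρ := ρ) (τ := τ)
  simp only [meanCover] at hmain
  set q := Fintype.card F
  set H := entropyBase q ρ
  have hq2 : (2 : ℝ) ≤ q := by exact_mod_cast hq
  have hq0 : (0 : ℝ) < q := by linarith
  have hq1 : (0 : ℝ) < (q : ℝ) - 1 := by linarith
  filter_upwards [eventually_ge_atTop q,
    (tendsto_natCast_atTop_atTop (R := ℝ)).eventually_ge_atTop ((q : ℝ) ^ 2 * (q - 1) / ρ)]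
    with n hqn hbig τ k hτ hτH hk
  have hn2 : 2 ≤ n := hq.trans hqn
  have hn2' : (2 : ℝ) ≤ n := by exact_mod_cast hn2
  have hn0 : (0 : ℝ) < n := by linarith
  set m := extraGenerators n
  set A : ℕ := 8 + 2 * q with hA
  have hqm : (q : ℝ) ^ m ≤ (q : ℝ) ^ 2 * (n : ℝ) ^ (2 * q) := by
    exact_mod_cast pow_extraGenerators_le (q := q) (n := n) (by omega)
  have hpow : (q : ℝ) ^ ((A : ℝ) * Real.logb q n) = (n : ℝ) ^ A := by
    rw [mul_comm, Real.rpow_mul hq0.le, Real.rpow_logb hq0 (by linarith) hn0, Real.rpow_natCast]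
  -- The power of `n` gained from the `log_q n` term pays for the extra generators, for the
  -- `n ^ 5`, and for the polynomial loss in the volume of the ball.
  have hgain : (n : ℝ) ^ 5 * (q : ℝ) ^ m * ((q - 1) * (n + 1) / ρ) ≤ (n : ℝ) ^ A := by
    calc (n : ℝ) ^ 5 * (q : ℝ) ^ m * ((q - 1) * (n + 1) / ρ)
        ≤ (n : ℝ) ^ 5 * ((q : ℝ) ^ 2 * (n : ℝ) ^ (2 * q)) * ((q - 1) * (n + 1) / ρ) := by
          gcongr
      _ = (n : ℝ) ^ 5 * (n : ℝ) ^ (2 * q) * ((q : ℝ) ^ 2 * (q - 1) / ρ) * (n + 1) := by ring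
      _ ≤ (n : ℝ) ^ 5 * (n : ℝ) ^ (2 * q) * n * (n : ℝ) ^ 2 := by
          gcongr
          nlinarith
      _ = (n : ℝ) ^ A := by
          rw [hA]
          ring
  have hc : 1 ≤ ((q : ℝ) - 1) * (n + 1) / ρ := by
    have hρ1 : ρ ≤ 1 := by
      have : 0 < 1 / (q : ℝ) := by positivity
      linarith
    rw [one_le_div h0]
    nlinarith
  have hmk : m ≤ k := by
    have h1 : (q : ℝ) ^ (m : ℝ) ≤ (q : ℝ) ^ ((A : ℝ) * Real.logb q n) := by
      rw [hpow, Real.rpow_natCast]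
      refine le_trans ?_ hgain
      have h5 : 1 ≤ (n : ℝ) ^ 5 := one_le_pow₀ (by linarith)
      calc (q : ℝ) ^ m = 1 * (q : ℝ) ^ m * 1 := by ring
        _ ≤ _ := by gcongr
    have h2 := (Real.rpow_le_rpow_left_iff (by linarith)).1 h1
    have h3 : 0 ≤ (n : ℝ) * (1 - τ - H) := mul_nonneg hn0.le (by linarith)
    exact_mod_cast (show (m : ℝ) ≤ k by linarith)
  have h := hmain (k - m) m n τ hn2 hτ ?_ (rpow_extraGenerators_lt hq hqn)
  · rwa [Nat.sub_add_cancel hmk] at h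
  have hcardV : (Fintype.card (Fin n → F) : ℝ) = (q : ℝ) ^ (n : ℝ) := by
    rw [Fintype.card_fun, Fintype.card_fin, Real.rpow_natCast]
    push_cast
    rfl
  rw [hcardV, ← Real.rpow_natCast (q : ℝ) (k - m), Nat.cast_sub hmk]
  have hvol' := hvol n
  have hexp : (q : ℝ) ^ (-((n : ℝ) * τ)) * ((n : ℝ) ^ A * ((q : ℝ) ^ m)⁻¹)
      ≤ (q : ℝ) ^ ((k : ℝ) - m) * (q : ℝ) ^ ((n : ℝ) * H) / (q : ℝ) ^ (n : ℝ) := by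
    rw [← hpow, ← Real.rpow_natCast (q : ℝ) m, ← Real.rpow_neg hq0.le, ← Real.rpow_add hq0,
      ← Real.rpow_add hq0, ← Real.rpow_add hq0, ← Real.rpow_sub hq0]
    exact Real.rpow_le_rpow_of_exponent_le (by linarith) (by linarith)
  have hs : 0 < (q : ℝ) ^ (-((n : ℝ) * τ)) := Real.rpow_pos_of_pos hq0 _
  have hQ : 0 < (q : ℝ) ^ (n : ℝ) := Real.rpow_pos_of_pos hq0 _
  have hK : 0 < (q : ℝ) ^ ((k : ℝ) - m) := Real.rpow_pos_of_pos hq0 _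
  calc (n : ℝ) ^ 5 * (q : ℝ) ^ (-((n : ℝ) * τ))
      = ρ / ((q - 1) * (n + 1)) * ((q : ℝ) ^ (-((n : ℝ) * τ)) *
          ((n : ℝ) ^ 5 * (q : ℝ) ^ m * ((q - 1) * (n + 1) / ρ) * ((q : ℝ) ^ m)⁻¹)) := by
        field_simp
    _ ≤ ρ / ((q - 1) * (n + 1)) * ((q : ℝ) ^ (-((n : ℝ) * τ)) *
          ((n : ℝ) ^ A * ((q : ℝ) ^ m)⁻¹)) := by gcongr
    _ ≤ ρ / ((q - 1) * (n + 1)) *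
          ((q : ℝ) ^ ((k : ℝ) - m) * (q : ℝ) ^ ((n : ℝ) * H) / (q : ℝ) ^ (n : ℝ)) := by gcongr
    _ = (q : ℝ) ^ ((k : ℝ) - m) *
          (ρ / ((q - 1) * (n + 1)) * (q : ℝ) ^ ((n : ℝ) * H)) / (q : ℝ) ^ (n : ℝ) := by ring
    _ ≤ _ := by gcongr

theorem tendsto_partialCoveringFraction {ρ : ℝ} (h0 : 0 < ρ)
    (hle : ρ ≤ 1 - 1 / (Fintype.card F : ℝ)) {τ : ℕ → ℝ}
    (hτ : ∀ n, 0 ≤ τ n ∧ τ n ≤ 1 - entropyBase (Fintype.card F) ρ) {k : ℕ → ℕ}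
    (hk : ∀ᶠ n : ℕ in atTop, n * (1 - τ n - entropyBase (Fintype.card F) ρ) +
        (8 + 2 * Fintype.card F : ℕ) * Real.logb (Fintype.card F) n ≤ k n) :
    Tendsto (fun n : ℕ => partialCoveringFraction F (k n) n ρ (τ n)) atTop (𝓝 1) := by
  have hlow := tendsto_extraGenerators_add_one_div.const_sub 1
  rw [sub_zero] at hlow
  refine tendsto_of_tendsto_of_tendsto_of_le_of_le' hlow tendsto_const_nhds ?_
    (Eventually.of_forall fun n => partialCoveringFraction_le_one (k n) n ρ (τ n))
  filter_upwards [eventually_le_partialCoveringFraction h0 hle, hk] with n h hkn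
  exact h (τ n) (k n) (hτ n).1 (hτ n).2 hkn

end Asymptotics

theorem theorem5 {F : Type*} [Field F] [Fintype F] [DecidableEq F] (ρ : ℝ)
    (hρ_pos : 0 < ρ) (hρ_le : ρ ≤ 1 - 1 / (Fintype.card F : ℝ)) :
    (∃ A : ℝ, ∀ τ : ℕ → ℝ,
      (∀ n, 0 ≤ τ n ∧ τ n ≤ 1 - entropyBase (Fintype.card F) ρ) →
      ∃ k : ℕ → ℕ, (∀ n, k n ≤ n) ∧
        (∀ᶠ n : ℕ in atTop,
          (k n : ℝ) / n ≤ 1 - τ n - entropyBase (Fintype.card F) ρ +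
            A * (Real.logb (Fintype.card F) n / n)) ∧
        Tendsto (fun n : ℕ => partialCoveringFraction F (k n) n ρ (τ n)) atTop (𝓝 1)) ∧
    (∀ τ : ℕ → ℝ,
      (∀ n, 0 ≤ τ n ∧ τ n ≤ 1 - entropyBase (Fintype.card F) ρ) →
      ∀ ε : ℝ, 0 < ε → ∀ k : ℕ → ℕ, (∀ n, k n ≤ n) →
        (∀ᶠ n : ℕ in atTop,
          1 - τ n - entropyBase (Fintype.card F) ρ + ε ≤ (k n : ℝ) / n) →
        Tendsto (fun n : ℕ => partialCoveringFraction F (k n) n ρ (τ n)) atTop (𝓝 1)) := by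
  have hq : 2 ≤ Fintype.card F := Fintype.one_lt_card
  have hlim := fun (τ : ℕ → ℝ) hτ (k : ℕ → ℕ) =>
    tendsto_partialCoveringFraction (F := F) hρ_pos hρ_le (τ := τ) hτ (k := k)
  set q := Fintype.card F
  set H := entropyBase q ρ with hH
  set A : ℕ := 8 + 2 * q
  have hq2 : (2 : ℝ) ≤ q := by exact_mod_cast hq
  have hρ1 : ρ < 1 := by
    have : 0 < 1 / (q : ℝ) := by positivity
    linarith
  -- Any positive multiple of `n` eventually dominates the logarithmic term.
  have hsmall : ∀ (c : ℝ) {ε : ℝ}, 0 < ε → ∀ᶠ n : ℕ in atTop, c * Real.logb q n ≤ ε * n := by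
    intro c ε hε
    have h := (tendsto_logb_div (q : ℝ)).const_mul c
    rw [mul_zero] at h
    filter_upwards [h.eventually_le_const hε, eventually_gt_atTop 0] with n hn hn0
    have hn0' : (0 : ℝ) < n := by exact_mod_cast hn0
    rwa [← mul_div_assoc, div_le_iff₀ hn0'] at hn
  have hlog1 : ∀ᶠ n : ℕ in atTop, 1 ≤ Real.logb q n := by
    filter_upwards [eventually_ge_atTop q] with n hn
    have hqn : (q : ℝ) ≤ n := by exact_mod_cast hn
    rw [Real.le_logb_iff_rpow_le (by linarith) (by linarith), Real.rpow_one]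
    exact hqn
  refine ⟨⟨A + 1, fun τ hτ => ?_⟩, fun τ hτ ε hε k _ hk => hlim τ hτ k ?_⟩
  · set L : ℕ → ℝ := fun n => n * (1 - τ n - H) + A * Real.logb q n with hL
    have hceil : ∀ᶠ n : ℕ in atTop, (⌈L n⌉₊ : ℝ) ≤ L n + 1 := by
      filter_upwards [hlog1] with n hn
      refine (Nat.ceil_lt_add_one ?_).le
      have := (hτ n).2
      exact add_nonneg (mul_nonneg (Nat.cast_nonneg n) (by linarith))
        (mul_nonneg (Nat.cast_nonneg A) (by linarith))
    refine ⟨fun n => min n ⌈L n⌉₊, fun n => min_le_left _ _, ?_, hlim τ hτ _ ?_⟩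
    · filter_upwards [hceil, hlog1, eventually_gt_atTop 0] with n h1 h2 hn0
      have hn0' : (0 : ℝ) < n := by exact_mod_cast hn0
      rw [div_le_iff₀ hn0']
      have hmin : ((min n ⌈L n⌉₊ : ℕ) : ℝ) ≤ ⌈L n⌉₊ := by exact_mod_cast min_le_right _ _
      calc ((min n ⌈L n⌉₊ : ℕ) : ℝ) ≤ L n + 1 := hmin.trans h1
        _ ≤ n * (1 - τ n - H) + A * Real.logb q n + Real.logb q n := by
          simp only [hL]
          linarith
        _ = (1 - τ n - H + (A + 1) * (Real.logb q n / n)) * n := by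
          field_simp
          ring
    · have hHpos : 0 < H := by
        rw [hH]
        exact div_pos (Real.qaryEntropy_pos hρ_pos hρ1) (Real.log_pos (by linarith))
      -- Since `H_q(ρ) > 0`, the cap at `n` is inactive when `n` is large.
      filter_upwards [hsmall (A + 1) hHpos, hlog1, hceil] with n h1 h2 h3
      have hle : ⌈L n⌉₊ ≤ n := by
        have hτn := mul_nonneg (Nat.cast_nonneg (α := ℝ) n) (hτ n).1
        have : (⌈L n⌉₊ : ℝ) ≤ n := by
          refine h3.trans ?_
          simp only [hL]
          linarith
        exact_mod_cast this
      rw [min_eq_right hle]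
      exact Nat.le_ceil (L n)
  · filter_upwards [hsmall A hε, hk, eventually_gt_atTop 0] with n h1 h2 hn0
    have hn0' : (0 : ℝ) < n := by exact_mod_cast hn0
    rw [le_div_iff₀ hn0'] at h2
    linarith
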